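/- A \emph{generalized non-crossing tree} (GNC-tree) on $n+1$ points ($n\ge 0$) is a tree whose vertices are $n+1$ points $0,1,\dots,n$ placed in counterclockwise order on a circle, whose edges, drawn as chords, do not cross, together with positive integer labels $\ell(0)\le \ell(1)\le\dots\le \ell(n)$ such that whenever $j$ is a label, every $i$ with $1\le i\le j$ is also a label (so $\ell(0)=1$). The tree is rooted at the point $0$. Reading paths away from the root, an edge from $v$ to $w$ is encoded by $u$ (ascent) if $\ell(v)<\ell(w)$, by $h$ (level) if $\ell(v)=\ell(w)$, and by $d$ (descent) if $\ell(v)>\ell(w)$. Let $u(T),h(T),d(T)$ be the numbers of ascents, levels and descents of $T$. For a word $\sigma$ on $\{u,h,d\}$, $T$ is \emph{$\sigma$-avoiding} if $\sigma$ does not occur as a block of consecutive letters in the word encoding any path starting at the root. Let $\mathsf{GNC}_n$ be the set of GNC-trees on $n+1$ points and $\mathsf{GNC}_n(\sigma)$ the subset of $\sigma$-avoiding ones, and put $$T_{x,y,z}(t)=\sum_{n\ge 0}t^n\sum_{T\in\mathsf{GNC}_n}x^{u(T)}y^{h(T)}z^{d(T)},\qquad T^{\sigma}_{x,y,z}(t)=\sum_{n\ge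 0}t^n\sum_{T\in\mathsf{GNC}_n(\sigma)}x^{u(T)}y^{h(T)}z^{d(T)}.$$ \textbf{Proposition.} The generating functions for $uu$-avoiding and for $dd$-avoiding GNC-trees satisfy $$T^{uu}_{1,1,1}(t)=\bigl(1-tT_{0,1,0}(t)^2+2tT^{uu}_{1,1,1}(t)T^{dd}_{1,1,1}(t)\bigr)\bigl(1+tT_{0,1,0}(t)^2T^{uu}_{1,1,1}(t)\bigr),$$ $$T^{dd}_{1,1,1}(t)=1+2t\,T^{dd}_{1,1,1}(t)^2\,T^{uu}_{1,1,1}(t),$$ and they are determined by these equations: over every commutative ring $R$ (for instance $R=\mathbb Z$), the pair $(T^{uu}_{1,1,1},T^{dd}_{1,1,1})$ is the only pair $(U,D)$ of formal power series in $R[[t]]$ with $U=(1-tT_{0,1,0}^2+2tUD)(1+tT_{0,1,0}^2U)$ and $D=1+2tD^2U$. -/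

import Mathlib

open scoped PowerSeries

/-- The three kinds of steps along a path read from the root:
`u` (ascent), `h` (level), `d` (descent). -/
inductive GNCStep : Type
  | u
  | h
  | d

/-- The code of a step from a vertex labelled `a` to a vertex labelled `b`. -/
def GNCStep.code (a b : ℕ) : GNCStep :=
  if a < b then GNCStep.u else if a = b then GNCStep.h else GNCStep.d

/-- A (rooted) generalized non-crossing tree on `n + 1` points.  The points `0, 1, …, n` lie on a
circle in counterclockwise order; point `0` is the root, and it carries the first label `1`. -/
@[ext]
structure GNCTree (n : ℕ) where
  graph : SimpleGraph (Fin (n + 1))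
  isTree : graph.IsTree
  /-- Two chords of the circle cross exactly when their end points interlace. -/
  noncrossing : ∀ a b c d : Fin (n + 1), a < b → b < c → c < d →
    ¬ (graph.Adj a c ∧ graph.Adj b d)
  label : Fin (n + 1) → ℕ
  label_pos : ∀ v, 1 ≤ label v
  /-- The labels increase weakly in counterclockwise order. -/
  label_mono : Monotone label
  /-- If `j` is a label, then so is every `i` with `1 ≤ i ≤ j`. -/
  label_surj : ∀ v, ∀ i : ℕ, 1 ≤ i → i ≤ label v → ∃ w, label w = i

namespace GNCTree

variable {n : ℕ}

theorem label_le (T : GNCTree n) (v : Fin (n + 1)) : T.label v ≤ n + 1 := by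
  have hsub : Finset.Icc 1 (T.label v) ⊆ Finset.univ.image T.label := by
    intro i hi
    rw [Finset.mem_Icc] at hi
    obtain ⟨w, hw⟩ := T.label_surj v i hi.1 hi.2
    exact Finset.mem_image.2 ⟨w, Finset.mem_univ w, hw⟩
  have hcard := (Finset.card_le_card hsub).trans Finset.card_image_le
  simpa using hcard

instance : Finite (GNCTree n) := by
  let f : GNCTree n → SimpleGraph (Fin (n + 1)) × (Fin (n + 1) → Fin (n + 2)) :=
    fun T => (T.graph, fun v => ⟨T.label v, Nat.lt_succ_of_le (T.label_le v)⟩)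
  refine Finite.of_injective f ?_
  intro S T hST
  have h1 : S.graph = T.graph := congrArg Prod.fst hST
  have h2 := congrArg Prod.snd hST
  refine GNCTree.ext h1 (funext fun v => ?_)
  exact congrArg Fin.val (congrFun h2 v)

noncomputable instance : Fintype (GNCTree n) := Fintype.ofFinite _

/-- The number of edges `(i, j)`, with `i` on the path from the root to `j`, whose code is `s`. -/
noncomputable def edgeCount (T : GNCTree n) (s : GNCStep) : ℕ :=
  Set.ncard {e : Fin (n + 1) × Fin (n + 1) | T.graph.Adj e.1 e.2 ∧
    (∃ p : T.graph.Walk 0 e.2, p.IsPath ∧ e.1 ∈ p.support) ∧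
    GNCStep.code (T.label e.1) (T.label e.2) = s}

/-- The word on `{u, h, d}` that encodes a walk. -/
def word (T : GNCTree n) {a b : Fin (n + 1)} (p : T.graph.Walk a b) : List GNCStep :=
  p.darts.map fun e => GNCStep.code (T.label e.fst) (T.label e.snd)

/-- `T` avoids `σ` if `σ` is not a block of consecutive letters of the word of any path that
starts at the root. -/
def Avoids (T : GNCTree n) (σ : List GNCStep) : Prop :=
  ∀ (v : Fin (n + 1)) (p : T.graph.Walk 0 v), p.IsPath → ¬ σ <:+: T.word p

/-- The weight `x ^ (number of ascents) * y ^ (number of levels) * z ^ (number of descents)`. -/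
noncomputable def weight {R : Type*} [CommRing R] (x y z : R) (T : GNCTree n) : R :=
  x ^ T.edgeCount GNCStep.u * y ^ T.edgeCount GNCStep.h * z ^ T.edgeCount GNCStep.d

/-- The generating function of all generalized non-crossing trees. -/
noncomputable def genFun {R : Type*} [CommRing R] (x y z : R) : R⟦X⟧ :=
  PowerSeries.mk fun n => ∑ T : GNCTree n, weight x y z T

open Classical in
/-- The generating function of the `σ`-avoiding generalized non-crossing trees. -/
noncomputable def avoidGenFun {R : Type*} [CommRing R] (σ : List GNCStep) (x y z : R) : R⟦X⟧ :=
  PowerSeries.mk fun n => ∑ T : GNCTree n with T.Avoids σ, weight x y z T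

end GNCTree

/-! Cut a tree at the largest child `c` of its root. Since chords do not cross, the descendants of
`c` that are at most `c` form an interval `k + 1, …, c`, and the points after `c` all descend from
`c`. This leaves a tree on `0, …, k`, a tree on `k + 1, …, c` rooted at its last point, and a tree
on `c, …, n`. The labels amount to one bit per gap `i | i + 1`; the gap `k | k + 1` lies in none of
the three pieces, and its free bit produces the factors 2. Reflecting the middle piece puts its root
first and exchanges ascents with descents, hence `uu` with `dd`. Iterating the cut identifies trees
with `NCCode` (`toGNC_injective`, `exists_toGNC_eq`).

The edge from `0` to `c` is never a descent, so `dd`-avoidance is independent in the three pieces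
(`avoidsDD_node`) and `D = 1 + 2X·D·U·D`. For `uu` (`avoidsUU_node`), either that edge is level, so
that the first two pieces have constant labels and the bit is 0, or it is an ascent and no ascent
may leave the root of the third piece. Let `A` count the trees with constant labels and `S` the
`uu`-avoiding trees without an ascent at the root. Then `S = 1 + X·A²·U` and `U = 1 + X·(A²·(U - S)
+ 2·U·D·S)`, and combining the two gives the stated product.

Uniqueness holds because in the difference of two solutions every term carries an extra factor `X`;
the series `A` enters only as a given coefficient. -/

/-! ### Recursive codes of trees -/

/-- Codes of generalized non-crossing trees rooted at their first point `0`.  If `c` is the largest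
child of the root, the points `≤ c` split into the points `0, …, k` outside the subtree of `c` and
the points `k + 1, …, c` inside it.  The code `node l m r b` records the tree on `0, …, k`, the
mirror image of the tree on `k + 1, …, c`, the tree on the points from `c` on, and whether the
label increases from `k` to `k + 1`. -/
inductive NCCode : Type
  | leaf
  | node (l m r : NCCode) (b : Bool)

namespace NCCode

/-- The number of edges. -/
def size : NCCode → ℕ
  | leaf => 0
  | node l m r _ => l.size + m.size + r.size + 1

/-- The parent of a point. -/
def par : NCCode → ℕ → ℕ
  | leaf, _ => 0
  | node l m r _, y =>
    if y ≤ l.size then l.par y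
    else if y < l.size + m.size + 1 then
      l.size + m.size + 1 - m.par (l.size + m.size + 1 - y)
    else if y = l.size + m.size + 1 then 0
    else l.size + m.size + 1 + r.par (y - (l.size + m.size + 1))

/-- Whether the label increases from `i` to `i + 1`. -/
def jump : NCCode → ℕ → Bool
  | leaf, _ => false
  | node l m r b, i =>
    if i < l.size then l.jump i
    else if i = l.size then b
    else if i < l.size + m.size + 1 then m.jump (l.size + m.size - i)
    else r.jump (i - (l.size + m.size + 1))

/-- A rank that increases along the edges. -/
def depth : NCCode → ℕ → ℕ
  | leaf, _ => 0
  | node l m r _, y =>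
    if y ≤ l.size then l.depth y
    else if y < l.size + m.size + 1 then m.depth (l.size + m.size + 1 - y) + 1
    else r.depth (y - (l.size + m.size + 1)) + 1

section Node

variable {l m r : NCCode} {b : Bool}

theorem size_node : (node l m r b).size = l.size + m.size + r.size + 1 := rfl

theorem par_node_left {y : ℕ} (h : y ≤ l.size) : (node l m r b).par y = l.par y := by
  rw [par, if_pos h]

theorem par_node_mid {y : ℕ} (h0 : 0 < y) (h : y ≤ m.size) :
    (node l m r b).par (l.size + m.size + 1 - y) = l.size + m.size + 1 - m.par y := by
  rw [par, if_neg (by omega), if_pos (by omega),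
    show l.size + m.size + 1 - (l.size + m.size + 1 - y) = y by omega]

theorem par_node_last : (node l m r b).par (l.size + m.size + 1) = 0 := by
  rw [par, if_neg (by omega), if_neg (by omega), if_pos rfl]

theorem par_node_right {y : ℕ} (h0 : 0 < y) :
    (node l m r b).par (l.size + m.size + 1 + y) = l.size + m.size + 1 + r.par y := by
  rw [par, if_neg (by omega), if_neg (by omega), if_neg (by omega), Nat.add_sub_cancel_left]

theorem jump_node_left {i : ℕ} (h : i < l.size) : (node l m r b).jump i = l.jump i := by
  rw [jump, if_pos h]

theorem jump_node_gap : (node l m r b).jump l.size = b := by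
  rw [jump, if_neg (by omega), if_pos rfl]

/-- Reflection sends the point `y` to `c - y` with `c = l.size + m.size + 1`, so the gap `i | i + 1`
becomes the gap with left end `c - 1 - i`. -/
theorem jump_node_mid {i : ℕ} (h : i < m.size) :
    (node l m r b).jump (l.size + m.size - i) = m.jump i := by
  rw [jump, if_neg (by omega), if_neg (by omega), if_pos (by omega),
    show l.size + m.size - (l.size + m.size - i) = i by omega]

theorem jump_node_right {i : ℕ} :
    (node l m r b).jump (l.size + m.size + 1 + i) = r.jump i := by
  rw [jump, if_neg (by omega), if_neg (by omega), if_neg (by omega), Nat.add_sub_cancel_left]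

theorem depth_node_left {y : ℕ} (h : y ≤ l.size) : (node l m r b).depth y = l.depth y := by
  rw [depth, if_pos h]

theorem node_point_cases {y : ℕ} (h : y ≤ (node l m r b).size) :
    y ≤ l.size ∨ (∃ x, 0 < x ∧ x ≤ m.size ∧ y = l.size + m.size + 1 - x) ∨
      y = l.size + m.size + 1 ∨ ∃ x, 0 < x ∧ x ≤ r.size ∧ y = l.size + m.size + 1 + x := by
  rw [size_node] at h
  by_cases h1 : y ≤ l.size
  · exact .inl h1
  by_cases h2 : y < l.size + m.size + 1
  · exact .inr (.inl ⟨l.size + m.size + 1 - y, by omega, by omega, by omega⟩)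
  by_cases h3 : y = l.size + m.size + 1
  · exact .inr (.inr (.inl h3))
  · exact .inr (.inr (.inr ⟨y - (l.size + m.size + 1), by omega, by omega, by omega⟩))

theorem node_gap_cases {i : ℕ} (h : i < (node l m r b).size) :
    i < l.size ∨ i = l.size ∨ (∃ j, j < m.size ∧ i = l.size + m.size - j) ∨
      ∃ j, j < r.size ∧ i = l.size + m.size + 1 + j := by
  rw [size_node] at h
  by_cases h1 : i < l.size
  · exact .inl h1
  by_cases h2 : i = l.size
  · exact .inr (.inl h2)
  by_cases h3 : i < l.size + m.size + 1
  · exact .inr (.inr (.inl ⟨l.size + m.size - i, by omega, by omega⟩))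
  · exact .inr (.inr (.inr ⟨i - (l.size + m.size + 1), by omega, by omega⟩))

end Node

theorem par_le (t : NCCode) {y : ℕ} (hy : y ≤ t.size) : t.par y ≤ t.size := by
  induction t generalizing y with
  | leaf => simp [par]
  | node l m r b ihl ihm ihr =>
    rcases node_point_cases hy with h | ⟨x, h0, h, rfl⟩ | rfl | ⟨x, h0, h, rfl⟩
    · rw [par_node_left h, size_node]; have := ihl h; omega
    · rw [par_node_mid h0 h, size_node]; omega
    · rw [par_node_last]; omega
    · rw [par_node_right h0, size_node]; have := ihr h; omega

@[simp] theorem depth_zero (t : NCCode) : t.depth 0 = 0 := by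
  induction t with
  | leaf => rfl
  | node l m r b ihl _ _ => simpa [depth] using ihl

theorem depth_node_mid {l m r : NCCode} {b : Bool} {y : ℕ} (h : y ≤ m.size) :
    (node l m r b).depth (l.size + m.size + 1 - y) = m.depth y + 1 := by
  rw [depth, if_neg (by omega)]
  split_ifs
  · rw [show l.size + m.size + 1 - (l.size + m.size + 1 - y) = y by omega]
  · obtain rfl : y = 0 := by omega
    simp

theorem depth_node_right {l m r : NCCode} {b : Bool} {y : ℕ} :
    (node l m r b).depth (l.size + m.size + 1 + y) = r.depth y + 1 := by
  rw [depth, if_neg (by omega), if_neg (by omega), Nat.add_sub_cancel_left]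

theorem depth_par_lt (t : NCCode) {y : ℕ} (h0 : 0 < y) (hy : y ≤ t.size) :
    t.depth (t.par y) < t.depth y := by
  induction t generalizing y with
  | leaf => simp only [size] at hy; omega
  | node l m r b ihl ihm ihr =>
    rcases node_point_cases hy with h | ⟨x, hx, h, rfl⟩ | rfl | ⟨x, hx, h, rfl⟩
    · rw [par_node_left h, depth_node_left h, depth_node_left (l.par_le h)]
      exact ihl h0 h
    · rw [par_node_mid hx h, depth_node_mid h, depth_node_mid (m.par_le h)]
      exact Nat.succ_lt_succ (ihm hx h)
    · rw [par_node_last, depth_zero, ← Nat.add_zero (_ + 1), depth_node_right]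
      omega
    · rw [par_node_right hx, depth_node_right, depth_node_right]
      exact Nat.succ_lt_succ (ihr hx h)

/-! ### Non-crossing and covering properties of codes -/

/-- The edges `{y, p y}` with `0 < y ≤ n` do not cross. -/
def NonCross (p : ℕ → ℕ) (n : ℕ) : Prop :=
  ∀ y z, 0 < y → y ≤ n → 0 < z → z ≤ n →
    ¬ (min y (p y) < min z (p z) ∧ min z (p z) < max y (p y) ∧ max y (p y) < max z (p z))

theorem nonCross_par (t : NCCode) : NonCross t.par t.size := by
  induction t with
  | leaf => intro y z h0 h1; simp only [size] at h1; omega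
  | node l m r b ihl ihm ihr =>
    intro y z hy0 hy hz0 hz
    rcases node_point_cases hy with h | ⟨x, hx, h, rfl⟩ | rfl | ⟨x, hx, h, rfl⟩ <;>
      rcases node_point_cases hz with k | ⟨w, hw, k, rfl⟩ | rfl | ⟨w, hw, k, rfl⟩ <;>
      simp only [par_node_left, par_node_mid, par_node_last, par_node_right, *]
    · exact ihl y z hy0 h hz0 k
    · have := l.par_le h; have := m.par_le k; omega
    · omega
    · have := l.par_le h; omega
    · have := l.par_le k; have := m.par_le h; omega
    -- The reflection reverses order, so the two edges trade places in the induction hypothesis.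
    · have := m.par_le h; have := m.par_le k; have := ihm w x hw k hx h; omega
    · omega
    · omega
    · have := l.par_le k; omega
    · have := m.par_le k; omega
    · omega
    · omega
    · have := l.par_le k; omega
    · have := m.par_le k; omega
    · omega
    · have := ihr x w hx h hw k; omega

/-- Every gap `i | i + 1` is covered by an edge. -/
theorem exists_cover (t : NCCode) {i : ℕ} (hi : i < t.size) :
    ∃ y, 0 < y ∧ y ≤ t.size ∧ min y (t.par y) ≤ i ∧ i < max y (t.par y) := by
  induction t generalizing i with
  | leaf => simp [size] at hi
  | node l m r b _ _ ihr =>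
    simp only [size] at hi ⊢
    by_cases h : i < l.size + m.size + 1
    · refine ⟨l.size + m.size + 1, by omega, by omega, ?_, by omega⟩
      simp [par_node_last]
    · obtain ⟨y, h0, h1, h2, h3⟩ := @ihr (i - (l.size + m.size + 1)) (by omega)
      refine ⟨l.size + m.size + 1 + y, by omega, by omega, ?_⟩
      rw [par_node_right h0]
      omega

/-! ### Recovering a code from its undirected graph -/

/-- Adjacency in the tree coded by `t`. -/
def Adj (t : NCCode) (x y : ℕ) : Prop :=
  (0 < y ∧ y ≤ t.size ∧ t.par y = x) ∨ (0 < x ∧ x ≤ t.size ∧ t.par x = y)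

theorem Adj.symm {t : NCCode} {x y : ℕ} (h : t.Adj x y) : t.Adj y x := Or.symm h

theorem par_ne (t : NCCode) {y : ℕ} (h0 : 0 < y) (hy : y ≤ t.size) : t.par y ≠ y := fun h => by
  have := t.depth_par_lt h0 hy
  rw [h] at this
  exact lt_irrefl _ this

theorem adj_node_left {l m r : NCCode} {b : Bool} {x y : ℕ} (hx : x ≤ l.size) (hy : y ≤ l.size) :
    (node l m r b).Adj x y ↔ l.Adj x y := by
  simp only [Adj, size_node, par_node_left hx, par_node_left hy]
  omega

theorem adj_node_mid {l m r : NCCode} {b : Bool} {x y : ℕ} (hx : x ≤ m.size) (hy : y ≤ m.size) :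
    (node l m r b).Adj (l.size + m.size + 1 - x) (l.size + m.size + 1 - y) ↔ m.Adj x y := by
  have bx := m.par_le hx
  have bY := m.par_le hy
  simp only [Adj, size_node]
  rcases x.eq_zero_or_pos with rfl | h0 <;> rcases y.eq_zero_or_pos with rfl | k0 <;>
    simp only [Nat.sub_zero, par_node_last, par_node_mid, true_and, *] <;> omega

theorem adj_node_right {l m r : NCCode} {b : Bool} {x y : ℕ} (hx : x ≤ r.size) (hy : y ≤ r.size) :
    (node l m r b).Adj (l.size + m.size + 1 + x) (l.size + m.size + 1 + y) ↔ r.Adj x y := by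
  simp only [Adj, size_node]
  rcases x.eq_zero_or_pos with rfl | h0 <;> rcases y.eq_zero_or_pos with rfl | k0 <;>
    simp only [Nat.add_zero, par_node_last, par_node_right, true_and, *] <;> omega

/-- With `adj_node_last`, this characterises the split point `l.size + m.size + 1` as the largest
neighbour of `0`, so the graph determines it. -/
theorem adj_node_root {l m r : NCCode} {b : Bool} {y : ℕ} (h : (node l m r b).Adj 0 y) :
    y ≤ l.size + m.size + 1 := by
  simp only [Adj, par, lt_irrefl, false_and, or_false] at h
  split_ifs at h <;> omega

theorem adj_node_last {l m r : NCCode} {b : Bool} :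
    (node l m r b).Adj 0 (l.size + m.size + 1) := by
  refine .inl ⟨by omega, ?_, par_node_last⟩
  rw [size_node]
  omega

/-- Only the edge to the largest child of the root covers the gap after the left part. -/
theorem not_adj_across {l m r : NCCode} {b : Bool} {x y : ℕ} (hx : x ≤ l.size) (hy : l.size < y)
    (hy' : y < l.size + m.size + 1) : ¬ (node l m r b).Adj x y := by
  have b1 := @par_le l x hx
  simp only [Adj, par, size]
  rw [if_neg (by omega), if_pos (by omega), if_pos hx]
  have b1 := @par_le m (l.size + m.size + 1 - y) (by omega)
  omega

theorem adj_cover (t : NCCode) {i : ℕ} (hi : i < t.size) :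
    ∃ x y, x ≤ i ∧ i < y ∧ y ≤ t.size ∧ t.Adj x y := by
  obtain ⟨y, h0, h1, h2, h3⟩ := t.exists_cover hi
  have := t.par_le h1
  rcases le_total y (t.par y) with h | h
  · exact ⟨y, t.par y, by omega, by omega, this, .inr ⟨h0, h1, rfl⟩⟩
  · exact ⟨t.par y, y, by omega, by omega, h1, .inl ⟨h0, h1, rfl⟩⟩

/-- If `l'` were larger, one of its edges would cover the gap just after `l` and end before the
largest child of the root, against `not_adj_across`. Used in both directions, this shows that the
graph determines the size of the left part. -/
theorem size_left_le {l m r l' m' r' : NCCode} {b b' : Bool}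
    (hc : l.size + m.size = l'.size + m'.size)
    (hadj : ∀ x y, x ≤ (node l m r b).size → y ≤ (node l m r b).size →
      ((node l m r b).Adj x y ↔ (node l' m' r' b').Adj x y)) : l'.size ≤ l.size := by
  by_contra! hlt
  obtain ⟨x, y, h1, h2, h3, h4⟩ := l'.adj_cover hlt
  refine not_adj_across (m := m) (r := r) (b := b) h1 h2 (by omega) ?_
  rw [hadj x y (by simp only [size]; omega) (by simp only [size]; omega)]
  exact (adj_node_left (by omega) h3).2 h4

/-- A code is determined by the adjacencies and the jumps. -/
theorem ext_of_adj_jump {t t' : NCCode} (hs : t.size = t'.size)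
    (hadj : ∀ x y, x ≤ t.size → y ≤ t.size → (t.Adj x y ↔ t'.Adj x y))
    (hjump : ∀ i, i < t.size → t.jump i = t'.jump i) : t = t' := by
  induction t generalizing t' with
  | leaf => cases t' with
    | leaf => rfl
    | node => simp [size] at hs
  | node l m r b ihl ihm ihr => cases t' with
    | leaf => simp [size] at hs
    | node l' m' r' b' =>
      have hs' : l.size + m.size + r.size = l'.size + m'.size + r'.size := by
        simpa [size] using hs
      have hc : l.size + m.size = l'.size + m'.size := by
        have h1 := adj_node_root ((hadj _ _ (by simp) (by simp only [size]; omega)).1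
          (adj_node_last (l := l) (m := m) (r := r) (b := b)))
        have h2 := adj_node_root ((hadj _ _ (by simp) (by simp only [size]; omega)).2
          (adj_node_last (l := l') (m := m') (r := r') (b := b')))
        omega
      have hl : l.size = l'.size := le_antisymm
        (size_left_le hc.symm fun x y hx hy =>
          (hadj x y (by rwa [hs]) (by rwa [hs])).symm) (size_left_le hc hadj)
      have hm : m.size = m'.size := by omega
      have hr : r.size = r'.size := by omega
      have hjl : ∀ i, i < l.size → l.jump i = l'.jump i := fun i hi => by
        have := hjump i (by rw [size_node]; omega)
        rwa [jump_node_left hi, jump_node_left (by omega)] at this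
      have hjm : ∀ i, i < m.size → m.jump i = m'.jump i := fun i hi => by
        have := hjump (l.size + m.size - i) (by rw [size_node]; omega)
        rwa [jump_node_mid hi, hl, hm, jump_node_mid (by omega)] at this
      have hjr : ∀ i, i < r.size → r.jump i = r'.jump i := fun i hi => by
        have := hjump (l.size + m.size + 1 + i) (by rw [size_node]; omega)
        rwa [jump_node_right, hl, hm, jump_node_right] at this
      have hb : b = b' := by
        have := hjump l.size (by rw [size_node]; omega)
        rwa [jump_node_gap, hl, jump_node_gap] at this
      have el := ihl hl (fun x y hx hy => by
        rw [← adj_node_left (l := l) (m := m) (r := r) (b := b) hx hy,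
          ← adj_node_left (l := l') (m := m') (r := r') (b := b') (by omega) (by omega)]
        exact hadj x y (by rw [size_node]; omega) (by rw [size_node]; omega)) hjl
      have em := ihm hm (fun x y hx hy => by
        rw [← adj_node_mid (l := l) (r := r) (b := b) hx hy,
          ← adj_node_mid (l := l') (m := m') (r := r') (b := b') (by omega) (by omega), ← hl, ← hm]
        exact hadj _ _ (by rw [size_node]; omega) (by rw [size_node]; omega)) hjm
      have er := ihr hr (fun x y hx hy => by
        rw [← adj_node_right (l := l) (m := m) (b := b) hx hy,
          ← adj_node_right (l := l') (m := m') (r := r') (b := b') (by omega) (by omega), ← hl,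
          ← hm]
        exact hadj _ _ (by rw [size_node]; omega) (by rw [size_node]; omega)) hjr
      rw [el, em, er, hb]

/-! ### Splitting an arbitrary non-crossing tree -/

/-- The descendants of `c` for the parent function `p` on `0, …, n`. -/
inductive Desc (p : ℕ → ℕ) (n c : ℕ) : ℕ → Prop
  | self : Desc p n c c
  | step (y : ℕ) : 0 < y → y ≤ n → Desc p n c (p y) → Desc p n c y

theorem exists_last_child {p d : ℕ → ℕ} {n : ℕ} (hn : 0 < n) (hp : ∀ y, 0 < y → y ≤ n → p y ≤ n)
    (hd : ∀ y, 0 < y → y ≤ n → d (p y) < d y) :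
    ∃ c, 0 < c ∧ c ≤ n ∧ p c = 0 ∧ ∀ y, c < y → y ≤ n → p y ≠ 0 := by
  -- A nonzero point of least rank can only have parent `0`.
  obtain ⟨y, ⟨h0, h1⟩, hmin⟩ := (measure d).wf.has_min {y | 0 < y ∧ y ≤ n} ⟨n, hn, le_rfl⟩
  have hy : p y = 0 := by
    by_contra h
    exact hmin (p y) ⟨Nat.pos_of_ne_zero h, hp y h0 h1⟩ (hd y h0 h1)
  have hne : ({y ∈ Finset.Icc 1 n | p y = 0} : Finset ℕ).Nonempty :=
    ⟨y, by simp only [Finset.mem_filter, Finset.mem_Icc]; omega⟩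
  obtain ⟨c, hc, hmax⟩ := Finset.exists_max_image _ id hne
  simp only [Finset.mem_filter, Finset.mem_Icc, id] at hc hmax
  refine ⟨c, by omega, by omega, hc.2, fun z hz hzn h => ?_⟩
  have := hmax z ⟨⟨by omega, hzn⟩, h⟩
  omega

/-- The points between a descendant of `c` and `c` are descendants of `c`. -/
theorem Desc.of_between {p d : ℕ → ℕ} {n c : ℕ}
    (hd : ∀ y, 0 < y → y ≤ n → d (p y) < d y) (hx : NonCross p n) (hc0 : 0 < c) (hcn : c ≤ n)
    (hpc : p c = 0) {x y : ℕ} (hxd : Desc p n c x) (hxy : x < y) (hyc : y < c) :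
    Desc p n c y := by
  by_contra hy
  have zero_not : ¬ Desc p n c 0 := fun h => by
    cases h <;> omega
  -- Take a counterexample `y` of least rank. Its parent lies left of `x`: a parent beyond `c` would
  -- cross the edge from `0` to `c`, and one between `x` and `c` would be a smaller counterexample.
  obtain ⟨y, ⟨hxy, hyc, hy⟩, hmin⟩ := (measure d).wf.has_min
    {y | x < y ∧ y < c ∧ ¬ Desc p n c y} ⟨y, hxy, hyc, hy⟩
  have hpy : ¬ Desc p n c (p y) := fun h => hy (.step y (by omega) (by omega) h)
  have hdy := hd y (by omega) (by omega)
  have hlt : p y < x := by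
    by_contra hge
    have hne : p y ≠ x := fun h => hpy (h ▸ hxd)
    have hne' : p y ≠ c := fun h => hpy (h ▸ .self)
    have h1 := hx c y hc0 hcn (by omega) (by omega)
    exact hmin (p y) ⟨by omega, by omega, hpy⟩ hdy
  -- A descendant `z` of least rank strictly between `p y` and `y` has its parent outside that
  -- interval, so its edge crosses the edge of `y`.
  obtain ⟨z, ⟨hz1, hz2, hz⟩, hmin'⟩ := (measure d).wf.has_min
    {z | p y < z ∧ z < y ∧ Desc p n c z} ⟨x, hlt, hxy, hxd⟩
  have hpz : Desc p n c (p z) := by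
    cases hz with
    | self => omega
    | step _ _ _ h => exact h
  have h1 : p z ≠ y := fun h => hy (h ▸ hpz)
  have h2 : p z ≠ p y := fun h => hpy (h ▸ hpz)
  have h3 : ¬ (p y < p z ∧ p z < y) := fun h => hmin' (p z) ⟨h.1, h.2, hpz⟩
    (hd z (by omega) (by omega))
  have h4 := hx y z (by omega) (by omega) (by omega) (by omega)
  have h5 := hx z y (by omega) (by omega) (by omega) (by omega)
  omega

theorem exists_split {p d : ℕ → ℕ} {n : ℕ} (hn : 0 < n) (hp : ∀ y, 0 < y → y ≤ n → p y ≤ n)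
    (hd : ∀ y, 0 < y → y ≤ n → d (p y) < d y) (hx : NonCross p n) :
    ∃ k c, k < c ∧ c ≤ n ∧ p c = 0 ∧ (∀ y, 0 < y → y ≤ k → p y ≤ k) ∧
      (∀ y, k < y → y < c → k < p y ∧ p y ≤ c) ∧ ∀ y, c < y → y ≤ n → c ≤ p y := by
  classical
  obtain ⟨c, hc0, hcn, hpc, hmax⟩ := exists_last_child hn hp hd
  have zero_not : ¬ Desc p n c 0 := fun h => by
    cases h <;> omega
  have hex : ∃ y, Desc p n c y := ⟨c, .self⟩
  -- The cut falls just before the least descendant `x` of `c`, that is, `k = x - 1`.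
  obtain ⟨x, hxd, hxmin⟩ : ∃ x, Desc p n c x ∧ ∀ y, y < x → ¬ Desc p n c y :=
    ⟨Nat.find hex, Nat.find_spec hex, fun y hy => Nat.find_min hex hy⟩
  have hx0 : x ≠ 0 := fun h => zero_not (h ▸ hxd)
  have hxc : x ≤ c := by
    by_contra h
    exact hxmin c (by omega) .self
  have hmid : ∀ y, x ≤ y → y ≤ c → Desc p n c y := fun y h1 h2 => by
    rcases h1.eq_or_lt with rfl | h1
    · exact hxd
    rcases h2.eq_or_lt with rfl | h2
    · exact .self
    exact hxd.of_between hd hx hc0 hcn hpc h1 h2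
  refine ⟨x - 1, c, by omega, hcn, hpc, fun y h1 h2 => ?_, fun y h1 h2 => ?_, fun y h1 h2 => ?_⟩
  · by_contra h
    have h3 := hx c y hc0 hcn h1 (by omega)
    exact hxmin y (by omega) (.step y h1 (by omega) (hmid _ (by omega) (by omega)))
  · have h3 := hx c y hc0 hcn (by omega) (by omega)
    have hy := hmid y (by omega) h2.le
    have hpy : Desc p n c (p y) := by
      cases hy with
      | self => omega
      | step _ _ _ h => exact h
    have h4 : ¬ p y < x := fun h => hxmin _ h hpy
    have h5 : p y ≠ 0 := fun h => zero_not (h ▸ hpy)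
    omega
  · have h3 := hx c y hc0 hcn (by omega) (by omega)
    have h4 := hmax y h1 h2
    omega

/-- Every non-crossing rooted tree with a set of label jumps has a code. -/
theorem exists_code (n : ℕ) (p d : ℕ → ℕ) (J : ℕ → Bool) (hp : ∀ y, 0 < y → y ≤ n → p y ≤ n)
    (hd : ∀ y, 0 < y → y ≤ n → d (p y) < d y) (hx : NonCross p n) :
    ∃ t : NCCode, t.size = n ∧ (∀ y, 0 < y → y ≤ n → t.par y = p y) ∧
      ∀ i, i < n → t.jump i = J i := by
  induction n using Nat.strong_induction_on generalizing p d J with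
  | _ n ih =>
  rcases n.eq_zero_or_pos with rfl | hn
  · exact ⟨leaf, rfl, fun y h0 h1 => by omega, fun i hi => by omega⟩
  obtain ⟨k, c, hkc, hcn, hpc, hl, hm, hr⟩ := exists_split hn hp hd hx
  obtain ⟨l, l1, l2, l3⟩ := ih k (by omega) p d J hl (fun y h0 h1 => hd y h0 (by omega))
    (fun y z hy hy' hz hz' => hx y z hy (by omega) hz (by omega))
  obtain ⟨m, m1, m2, m3⟩ := ih (c - 1 - k) (by omega) (fun y => c - p (c - y)) (fun y => d (c - y))
    (fun i => J (c - 1 - i)) (fun y h0 h1 => by have := hm (c - y) (by omega) (by omega); omega)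
    (fun y h0 h1 => by
      have := hm (c - y) (by omega) (by omega)
      rw [show c - (c - p (c - y)) = p (c - y) by omega]
      exact hd _ (by omega) (by omega))
    (fun y z hy hy' hz hz' => by
      have h1 := hm (c - y) (by omega) (by omega)
      have h2 := hm (c - z) (by omega) (by omega)
      have := hx (c - z) (c - y) (by omega) (by omega) (by omega) (by omega)
      beta_reduce
      omega)
  obtain ⟨r, r1, r2, r3⟩ := ih (n - c) (by omega) (fun y => p (c + y) - c) (fun y => d (c + y))
    (fun i => J (c + i)) (fun y h0 h1 => by have := hp (c + y) (by omega) (by omega); omega)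
    (fun y h0 h1 => by
      have := hr (c + y) (by omega) (by omega)
      rw [show c + (p (c + y) - c) = p (c + y) by omega]
      exact hd _ (by omega) (by omega))
    (fun y z hy hy' hz hz' => by
      have h1 := hr (c + y) (by omega) (by omega)
      have h2 := hr (c + z) (by omega) (by omega)
      have := hx (c + y) (c + z) (by omega) (by omega) (by omega) (by omega)
      beta_reduce
      omega)
  have hc : c = l.size + m.size + 1 := by omega
  have hs : (node l m r (J k)).size = n := by rw [size_node]; omega
  refine ⟨node l m r (J k), hs, fun y h0 h1 => ?_, fun i hi => ?_⟩
  · rcases node_point_cases (h1.trans hs.ge) with h | ⟨x, x0, h, rfl⟩ | rfl | ⟨x, x0, h, rfl⟩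
    · rw [par_node_left h, l2 y h0 (by omega)]
    · have := hm (c - x) (by omega) (by omega)
      rw [par_node_mid x0 h, m2 x x0 (by omega), ← hc]
      omega
    · rw [par_node_last, ← hc, hpc]
    · have := hr (c + x) (by omega) (by omega)
      rw [par_node_right x0, r2 x x0 (by omega), ← hc]
      omega
  · rcases node_gap_cases (hi.trans_eq hs.symm) with h | rfl | ⟨j, h, rfl⟩ | ⟨j, h, rfl⟩
    · rw [jump_node_left h, l3 i (by omega)]
    · rw [jump_node_gap, l1]
    · rw [jump_node_mid h, m3 j (by omega)]
      congr 1
      omega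
    · rw [jump_node_right, r3 j (by omega), hc]

/-! ### Labels from jumps -/

/-- The label of a point. -/
def lab (t : NCCode) (v : ℕ) : ℕ := 1 + Nat.count (fun i => t.jump i = true) v

/-- The label increases somewhere between `x` and `y`. -/
def Up (t : NCCode) (x y : ℕ) : Prop := ∃ i, x ≤ i ∧ i < y ∧ t.jump i = true

theorem lab_mono (t : NCCode) : Monotone t.lab := fun _ _ h =>
  Nat.add_le_add_left (Nat.count_monotone _ h) 1

theorem lab_zero (t : NCCode) : t.lab 0 = 1 := by simp [lab]

theorem lab_succ (t : NCCode) (i : ℕ) :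
    t.lab (i + 1) = t.lab i + if t.jump i = true then 1 else 0 := by
  rw [lab, Nat.count_succ, lab, add_assoc]

theorem lab_lt_iff (t : NCCode) {x y : ℕ} : t.lab x < t.lab y ↔ t.Up x y := by
  constructor
  · intro h
    by_contra hn
    have key : ∀ k, x + k ≤ y → t.lab (x + k) = t.lab x := by
      intro k
      induction k with
      | zero => simp
      | succ k ih =>
        intro hk
        rw [← add_assoc, lab_succ, ih (by omega), if_neg, add_zero]
        exact fun hj => hn ⟨x + k, by omega, by omega, hj⟩
    rcases le_total x y with hxy | hxy
    · have := key (y - x) (by omega)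
      rw [Nat.add_sub_cancel' hxy] at this
      omega
    · exact absurd (t.lab_mono hxy) (by omega)
  · rintro ⟨i, h1, h2, h3⟩
    have h4 := t.lab_mono h1
    have h5 := t.lab_mono (show i + 1 ≤ y from h2)
    rw [lab_succ, if_pos h3] at h5
    omega

theorem code_eq_u (t : NCCode) {x y : ℕ} :
    GNCStep.code (t.lab x) (t.lab y) = GNCStep.u ↔ t.Up x y := by
  rw [← lab_lt_iff, GNCStep.code]
  split_ifs <;> simp_all

theorem code_eq_d (t : NCCode) {x y : ℕ} :
    GNCStep.code (t.lab x) (t.lab y) = GNCStep.d ↔ t.Up y x := by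
  rw [← lab_lt_iff, GNCStep.code]
  split_ifs with h1 h2 <;> simp <;> omega

theorem exists_lab_eq (t : NCCode) (v i : ℕ) (h1 : 1 ≤ i) (h2 : i ≤ t.lab v) :
    ∃ w, w ≤ v ∧ t.lab w = i := by
  induction v with
  | zero => exact ⟨0, le_rfl, by rw [lab_zero] at *; omega⟩
  | succ v ih =>
    rcases h2.eq_or_lt with h | h
    · exact ⟨v + 1, le_rfl, h.symm⟩
    · obtain ⟨w, hw, e⟩ := ih (by rw [lab_succ] at h; split_ifs at h <;> omega)
      exact ⟨w, by omega, e⟩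

/-! ### The tree of a code -/

/-- The graph of the tree coded by `t`. -/
def graph (t : NCCode) (n : ℕ) (_ : t.size = n) : SimpleGraph (Fin (n + 1)) where
  Adj x y := t.Adj x y
  symm := ⟨fun _ _ h => h.symm⟩
  loopless := ⟨fun x hx => by
    rcases hx with ⟨h0, h1, h2⟩ | ⟨h0, h1, h2⟩ <;> exact t.par_ne h0 h1 h2⟩

/-- The parent of a point, as a vertex of the graph. -/
def parFin (t : NCCode) (n : ℕ) (h : t.size = n) (v : Fin (n + 1)) : Fin (n + 1) :=
  ⟨t.par v, Nat.lt_succ_of_le ((t.par_le (by omega)).trans h.le)⟩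

section Graph

variable {t : NCCode} {n : ℕ} {h : t.size = n}

theorem adj_parFin {v : Fin (n + 1)} (hv : 0 < (v : ℕ)) :
    (t.graph n h).Adj (t.parFin n h v) v :=
  .inl ⟨hv, by omega, rfl⟩

/-- The depth bound keeps `v` off the path to its parent, so that path extends to `v`. Once paths
are known to be unique, the description of the darts holds for every path from the root. -/
theorem exists_path (v : Fin (n + 1)) : ∃ p : (t.graph n h).Walk 0 v, p.IsPath ∧
    (∀ e ∈ p.darts, 0 < (e.snd : ℕ) ∧ t.par e.snd = e.fst) ∧
    ∀ x ∈ p.support, t.depth x ≤ t.depth v := by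
  induction hd : t.depth v using Nat.strong_induction_on generalizing v with
  | _ k ih =>
  by_cases hv : v = 0
  · subst hv
    exact ⟨.nil, by simp, by simp, by simp [← hd]⟩
  have hv0 : 0 < (v : ℕ) := Nat.pos_of_ne_zero fun h => hv (Fin.ext h)
  have hlt : t.depth (t.parFin n h v) < t.depth v := t.depth_par_lt hv0 (by omega)
  obtain ⟨p, hp, hd1, hd2⟩ := ih _ (hd ▸ hlt) (t.parFin n h v) rfl
  refine ⟨p.concat (adj_parFin hv0), hp.concat (fun hmem => ?_) _, ?_, ?_⟩
  · exact absurd (hd2 v hmem) (by omega)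
  · intro e he
    rw [SimpleGraph.Walk.darts_concat, List.concat_eq_append, List.mem_append] at he
    rcases he with he | he
    · exact hd1 e he
    · rw [List.mem_singleton] at he
      subst he
      exact ⟨hv0, rfl⟩
  · intro x hx
    rw [SimpleGraph.Walk.support_concat, List.mem_append] at hx
    rcases hx with hx | hx
    · have := hd2 x hx; omega
    · rw [List.mem_singleton] at hx
      subst hx
      exact hd.le

/-- The graph is connected, and sending `i` to the edge from `i + 1` to its parent is onto the
edges, so there are at most `n` of them. -/
theorem graph_isTree : (t.graph n h).IsTree := by
  rw [SimpleGraph.isTree_iff_connected_and_card]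
  have hc : (t.graph n h).Connected := by
    rw [SimpleGraph.connected_iff_exists_forall_reachable]
    exact ⟨0, fun v => ⟨(exists_path v).choose⟩⟩
  refine ⟨hc, le_antisymm ?_ hc.card_vert_le_card_edgeSet_add_one⟩
  have : Nat.card (t.graph n h).edgeSet ≤ Nat.card (Fin n) := by
    refine Nat.card_le_card_of_surjective
      (fun i => ⟨s(t.parFin n h i.succ, i.succ), adj_parFin (h := h) (by simp)⟩) ?_
    rintro ⟨e, he⟩
    induction e with
    | _ x y =>
    rcases he with ⟨h0, h1, h2⟩ | ⟨h0, h1, h2⟩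
    · refine ⟨⟨(y : ℕ) - 1, by omega⟩, Subtype.ext ?_⟩
      have e : (⟨(y : ℕ) - 1, by omega⟩ : Fin n).succ = y := Fin.ext (Nat.sub_add_cancel h0)
      simp only [e]
      exact congrArg (s(·, y)) (Fin.ext h2)
    · refine ⟨⟨(x : ℕ) - 1, by omega⟩, Subtype.ext ?_⟩
      have e : (⟨(x : ℕ) - 1, by omega⟩ : Fin n).succ = x := Fin.ext (Nat.sub_add_cancel h0)
      simp only [e]
      rw [Sym2.eq_swap]
      exact congrArg (s(x, ·)) (Fin.ext h2)
  simpa using this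

theorem Adj.exists_max {x y : ℕ} (hxy : x < y) (ha : t.Adj x y) :
    ∃ z, 0 < z ∧ z ≤ t.size ∧ min z (t.par z) = x ∧ max z (t.par z) = y := by
  rcases ha with ⟨h0, h1, h2⟩ | ⟨h0, h1, h2⟩
  · exact ⟨y, h0, h1, by omega, by omega⟩
  · exact ⟨x, h0, h1, by omega, by omega⟩

end Graph

/-- The generalized non-crossing tree coded by `t`. -/
def toGNC (t : NCCode) (n : ℕ) (h : t.size = n) : GNCTree n where
  graph := t.graph n h
  isTree := graph_isTree
  noncrossing := by
    rintro a b c d hab hbc hcd ⟨hac, hbd⟩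
    obtain ⟨y, y0, y1, y2, y3⟩ := Adj.exists_max (t := t) (hab.trans hbc) hac
    obtain ⟨z, z0, z1, z2, z3⟩ := Adj.exists_max (t := t) (hbc.trans hcd) hbd
    exact t.nonCross_par y z y0 y1 z0 z1
      ⟨by rw [y2, z2]; exact hab, by rw [y3, z2]; exact hbc, by rw [y3, z3]; exact hcd⟩
  label v := t.lab v
  label_pos _ := Nat.le_add_right 1 _
  label_mono _ _ h := t.lab_mono h
  label_surj v i h1 h2 := by
    obtain ⟨w, hw, e⟩ := t.exists_lab_eq v i h1 h2
    exact ⟨⟨w, by omega⟩, e⟩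

theorem toGNC_injective {n : ℕ} {t t' : NCCode} {h : t.size = n} {h' : t'.size = n}
    (e : t.toGNC n h = t'.toGNC n h') : t = t' := by
  refine ext_of_adj_jump (h.trans h'.symm) (fun x y hx hy => ?_) (fun i hi => ?_)
  · have := congrArg (fun T : GNCTree n => T.graph.Adj ⟨x, by omega⟩ ⟨y, by omega⟩) e
    exact iff_of_eq this
  · have h1 : t.lab i = t'.lab i :=
      congrArg (fun T : GNCTree n => T.label ⟨i, by omega⟩) e
    have h2 : t.lab (i + 1) = t'.lab (i + 1) :=
      congrArg (fun T : GNCTree n => T.label ⟨i + 1, by omega⟩) e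
    rw [lab_succ, lab_succ, h1] at h2
    cases e1 : t.jump i <;> cases e2 : t'.jump i <;> simp_all

end NCCode

/-! ### Every tree has a code -/

namespace GNCTree

open NCCode

variable {n : ℕ}

theorem exists_closer (T : GNCTree n) {v : Fin (n + 1)} (hv : v ≠ 0) :
    ∃ w, T.graph.Adj w v ∧ T.graph.dist 0 w < T.graph.dist 0 v := by
  obtain ⟨p, hp⟩ := T.isTree.connected.exists_walk_length_eq_dist v 0
  cases p with
  | nil => exact absurd rfl hv
  | cons hadj q =>
    refine ⟨_, hadj.symm, ?_⟩
    rw [SimpleGraph.dist_comm, SimpleGraph.dist_comm (u := 0), ← hp, SimpleGraph.Walk.length_cons]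
    exact Nat.lt_succ_of_le (SimpleGraph.dist_le q)

theorem label_zero (T : GNCTree n) : T.label 0 = 1 := by
  obtain ⟨w, hw⟩ := T.label_surj 0 1 le_rfl (T.label_pos 0)
  have := T.label_mono (Fin.zero_le w)
  exact le_antisymm (by omega) (T.label_pos 0)

theorem label_succ_le (T : GNCTree n) (i : ℕ) (hi : i < n) :
    T.label ⟨i + 1, by omega⟩ ≤ T.label ⟨i, by omega⟩ + 1 := by
  by_contra! hlt
  obtain ⟨w, hw⟩ := T.label_surj ⟨i + 1, by omega⟩ (T.label ⟨i, by omega⟩ + 1) (by omega) hlt.le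
  rcases Nat.lt_or_ge i w with h | h
  · have := T.label_mono (show (⟨i + 1, by omega⟩ : Fin (n + 1)) ≤ w from h)
    omega
  · have := T.label_mono (show w ≤ (⟨i, by omega⟩ : Fin (n + 1)) from h)
    omega

/-- The parent of a vertex is chosen as a neighbour closer to the root, and the distance to the root
serves as the rank required by `exists_code`. -/
theorem exists_toGNC_eq (T : GNCTree n) : ∃ (t : NCCode) (h : t.size = n), t.toGNC n h = T := by
  have hc : ∀ v : Fin (n + 1), ∃ w, v ≠ 0 → T.graph.Adj w v ∧
      T.graph.dist 0 w < T.graph.dist 0 v := fun v => by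
    by_cases hv : v = 0
    · exact ⟨0, fun h => absurd hv h⟩
    · obtain ⟨w, hw⟩ := T.exists_closer hv
      exact ⟨w, fun _ => hw⟩
  choose q hq using hc
  have ne_zero : ∀ {v : Fin (n + 1)}, 0 < (v : ℕ) → v ≠ 0 := fun h e => by simp [e] at h
  let p : ℕ → ℕ := fun y => if hy : y < n + 1 then q ⟨y, hy⟩ else 0
  have hp : ∀ v : Fin (n + 1), p v = q v := fun v => by simp only [p, dif_pos v.2]
  let d : ℕ → ℕ := fun y => if hy : y < n + 1 then T.graph.dist 0 ⟨y, hy⟩ else 0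
  have hd : ∀ v : Fin (n + 1), d v = T.graph.dist 0 v := fun v => by simp only [d, dif_pos v.2]
  let J : ℕ → Bool := fun i => if hi : i < n then
    decide (T.label ⟨i, by omega⟩ < T.label ⟨i + 1, by omega⟩) else false
  have hcross : ∀ x x' y y' : Fin (n + 1), T.graph.Adj x x' → T.graph.Adj y y' →
      ¬ (min x x' < min y y' ∧ min y y' < max x x' ∧ max x x' < max y y') := by
    rintro x x' y y' hx hy ⟨h1, h2, h3⟩
    refine T.noncrossing _ _ _ _ h1 h2 h3 ⟨?_, ?_⟩
    · rcases le_total x x' with h | h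
      · rwa [min_eq_left h, max_eq_right h]
      · rw [min_eq_right h, max_eq_left h]; exact hx.symm
    · rcases le_total y y' with h | h
      · rwa [min_eq_left h, max_eq_right h]
      · rw [min_eq_right h, max_eq_left h]; exact hy.symm
  obtain ⟨t, h, hpar, hjump⟩ := exists_code n p d J
    (fun y h0 h1 => by
      have := hp ⟨y, by omega⟩
      simp only at this
      omega)
    (fun y h0 h1 => by
      have h2 := hp ⟨y, by omega⟩
      simp only at h2
      rw [h2, hd]
      have := (hq ⟨y, by omega⟩ (ne_zero h0)).2
      rwa [← hd ⟨y, by omega⟩] at this)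
    (fun y z y0 y1 z0 z1 => by
      have h2 := hp ⟨y, by omega⟩
      have h3 := hp ⟨z, by omega⟩
      simp only at h2 h3
      have := hcross ⟨y, by omega⟩ _ ⟨z, by omega⟩ _ (hq ⟨y, by omega⟩ (ne_zero y0)).1.symm
        (hq ⟨z, by omega⟩ (ne_zero z0)).1.symm
      rw [h2, h3]
      simpa only [Fin.lt_def, Fin.coe_min, Fin.coe_max] using this)
  have hle : t.graph n h ≤ T.graph := by
    have key : ∀ x y : Fin (n + 1), 0 < (y : ℕ) → t.par y = x → T.graph.Adj x y := by
      intro x y h0 h1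
      rw [hpar y h0 (by omega), hp] at h1
      rw [← Fin.ext h1]
      exact (hq y (ne_zero h0)).1
    intro x y hxy
    rcases hxy with ⟨h0, h1, h2⟩ | ⟨h0, h1, h2⟩
    · exact key x y h0 h2
    · exact (key y x h0 h2).symm
  have hlab : ∀ i (hi : i < n + 1), t.lab i = T.label ⟨i, hi⟩ := by
    intro i
    induction i with
    | zero => intro _; rw [lab_zero]; exact T.label_zero.symm
    | succ i ih =>
      intro hi
      rw [lab_succ, ih (by omega), hjump i (by omega)]
      have h1 := T.label_succ_le i (by omega)
      have h2 := T.label_mono (show (⟨i, by omega⟩ : Fin (n + 1)) ≤ ⟨i + 1, hi⟩ by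
        simp [Fin.le_def])
      simp only [J, dif_pos (show i < n by omega), decide_eq_true_eq]
      split_ifs <;> omega
  refine ⟨t, h, GNCTree.ext ?_ (funext fun v => hlab v v.2)⟩
  refine le_antisymm hle ?_
  -- A tree is a minimal connected graph, so the inclusion of the coded tree in `T.graph` is an
  -- equality.
  have := (SimpleGraph.isTree_iff_minimal_connected.1 T.isTree).2
    (graph_isTree (t := t) (h := h)).connected hle
  exact this

end GNCTree

/-! ### Pattern avoidance read on codes -/

namespace NCCode

/-- No two consecutive ascents on a path from the root. -/
def AvoidsUU (t : NCCode) : Prop := ∀ z, 0 < z → z ≤ t.size → 0 < t.par z →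
  ¬ (t.Up (t.par (t.par z)) (t.par z) ∧ t.Up (t.par z) z)

/-- No two consecutive descents on a path from the root. -/
def AvoidsDD (t : NCCode) : Prop := ∀ z, 0 < z → z ≤ t.size → 0 < t.par z →
  ¬ (t.Up (t.par z) (t.par (t.par z)) ∧ t.Up z (t.par z))

/-- All labels are equal. -/
def Flat (t : NCCode) : Prop := ∀ i, i < t.size → t.jump i = false

/-- Some edge at the root is an ascent. -/
def StartsUp (t : NCCode) : Prop := ∃ y, 0 < y ∧ y ≤ t.size ∧ t.par y = 0 ∧ t.Up 0 y

section Graph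

variable {t : NCCode} {n : ℕ} {h : t.size = n}

theorem isPath_concat_parFin {v : Fin (n + 1)} (hv : 0 < (v : ℕ))
    {p : (t.graph n h).Walk 0 (t.parFin n h v)} (hp : p.IsPath) :
    (p.concat (adj_parFin hv)).IsPath := by
  refine hp.concat (fun hmem => ?_) _
  obtain ⟨q, hq, -, hd⟩ := exists_path (h := h) (t.parFin n h v)
  obtain rfl := (graph_isTree.existsUnique_path _ _).unique hp hq
  have h1 : t.depth (t.parFin n h v) < t.depth v := t.depth_par_lt hv (by omega)
  exact absurd (hd v hmem) (by omega)

theorem par_of_mem_darts {v : Fin (n + 1)} {p : (t.graph n h).Walk 0 v} (hp : p.IsPath)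
    {e : (t.graph n h).Dart} (he : e ∈ p.darts) : 0 < (e.snd : ℕ) ∧ t.par e.snd = e.fst := by
  obtain ⟨q, hq, hd, -⟩ := exists_path (h := h) v
  obtain rfl := (graph_isTree.existsUnique_path _ _).unique hp hq
  exact hd e he

/-- Two consecutive edges of a path from the root always run from grandparent to parent to child,
and each such pair ends some path from the root. -/
theorem toGNC_avoids_pair {s s' : GNCStep} :
    (t.toGNC n h).Avoids [s, s'] ↔ ∀ z, 0 < z → z ≤ t.size → 0 < t.par z →
      ¬ (GNCStep.code (t.lab (t.par (t.par z))) (t.lab (t.par z)) = s ∧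
        GNCStep.code (t.lab (t.par z)) (t.lab z) = s') := by
  constructor
  · rintro hA z h0 h1 h2 ⟨e1, e2⟩
    let v : Fin (n + 1) := ⟨z, by omega⟩
    obtain ⟨p, hp, -⟩ := exists_path (h := h) (t.parFin n h (t.parFin n h v))
    have hp1 := isPath_concat_parFin (v := t.parFin n h v) h2 hp
    have hp2 := isPath_concat_parFin (v := v) h0 hp1
    refine hA v _ hp2 ⟨(t.toGNC n h).word p, [], ?_⟩
    have hdarts : ((p.concat (adj_parFin h2)).concat (adj_parFin (v := v) h0)).darts =
        p.darts ++ [⟨(t.parFin n h (t.parFin n h v), t.parFin n h v), adj_parFin h2⟩,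
          ⟨(t.parFin n h v, v), adj_parFin h0⟩] := by
      simp [SimpleGraph.Walk.darts_concat]
    rw [List.append_nil, ← e1, ← e2]
    exact (List.map_append.symm.trans (congrArg (List.map _) hdarts.symm))
  · intro hA v p hp hin
    obtain ⟨l, hl, e⟩ := List.infix_map_iff.1 hin
    obtain ⟨a, b, rfl⟩ : ∃ a b, l = [a, b] := by
      rcases l with _ | ⟨a, _ | ⟨b, _ | ⟨c, l⟩⟩⟩ <;> simp at e
      exact ⟨a, b, rfl⟩
    obtain ⟨a0, a1⟩ := par_of_mem_darts (h := h) hp (hl.subset (by simp : a ∈ [a, b]))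
    obtain ⟨b0, b1⟩ := par_of_mem_darts (h := h) hp (hl.subset (by simp : b ∈ [a, b]))
    have hch := (SimpleGraph.Walk.isChain_dartAdj_darts p).infix hl
    have hab : a.snd = b.fst := (List.isChain_cons_cons.1 hch).1
    simp only [List.map_cons, List.map_nil, List.cons.injEq, and_true] at e
    refine hA b.snd b0 (by omega) (by rw [b1, ← hab]; exact a0) ⟨?_, ?_⟩
    · rw [b1, ← hab, a1]; exact e.1.symm
    · rw [b1]; exact e.2.symm

theorem toGNC_avoids_uu :
    (t.toGNC n h).Avoids [GNCStep.u, GNCStep.u] ↔ t.AvoidsUU := by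
  simp only [toGNC_avoids_pair, code_eq_u, AvoidsUU]

theorem toGNC_avoids_dd :
    (t.toGNC n h).Avoids [GNCStep.d, GNCStep.d] ↔ t.AvoidsDD := by
  simp only [toGNC_avoids_pair, code_eq_d, AvoidsDD]

theorem edgeCount_eq_zero_iff (T : GNCTree n) (s : GNCStep) : T.edgeCount s = 0 ↔
    ∀ (x y : Fin (n + 1)), T.graph.Adj x y →
      (∃ p : T.graph.Walk 0 y, p.IsPath ∧ x ∈ p.support) →
        GNCStep.code (T.label x) (T.label y) ≠ s := by
  rw [GNCTree.edgeCount, Set.ncard_eq_zero, Set.eq_empty_iff_forall_notMem]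
  simp only [Set.mem_ofPred_eq, Prod.forall, not_and, ne_eq]

theorem Flat.not_up (hf : t.Flat) {x y : ℕ} (hy : y ≤ t.size) : ¬ t.Up x y := by
  rintro ⟨i, h1, h2, h3⟩
  simp [hf i (by omega)] at h3

/-- Every gap is covered by an edge, so a single jump already forces an ascent or a descent. -/
theorem toGNC_edgeCount_eq_zero :
    ((t.toGNC n h).edgeCount GNCStep.u = 0 ∧ (t.toGNC n h).edgeCount GNCStep.d = 0) ↔
      t.Flat := by
  simp only [edgeCount_eq_zero_iff]
  constructor
  · rintro ⟨hu, hd⟩ i hi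
    by_contra hj
    rw [Bool.not_eq_false] at hj
    obtain ⟨y, h0, h1, h2, h3⟩ := t.exists_cover hi
    let v : Fin (n + 1) := ⟨y, by omega⟩
    obtain ⟨p, hp, -⟩ := exists_path (h := h) (t.parFin n h v)
    have hp1 := isPath_concat_parFin (v := v) h0 hp
    have hex : ∃ p : (t.graph n h).Walk 0 v, p.IsPath ∧ t.parFin n h v ∈ p.support :=
      ⟨_, hp1, by rw [SimpleGraph.Walk.support_concat]; simp⟩
    rcases le_total y (t.par y) with hle | hle
    · exact hd _ v (adj_parFin h0) hex (t.code_eq_d.2 ⟨i, (by omega : y ≤ i),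
        (by omega : i < t.par y), hj⟩)
    · exact hu _ v (adj_parFin h0) hex
        (t.code_eq_u.2 ⟨i, (by omega : t.par y ≤ i), (by omega : i < y), hj⟩)
  · intro hf
    exact ⟨fun x y _ _ e => hf.not_up (by omega) (t.code_eq_u.1 e),
      fun x y _ _ e => hf.not_up (by omega) (t.code_eq_d.1 e)⟩

end Graph

theorem Flat.avoidsUU {t : NCCode} (hf : t.Flat) : t.AvoidsUU :=
  fun _ _ hz _ h => hf.not_up hz h.2

theorem Flat.avoidsDD {t : NCCode} (hf : t.Flat) : t.AvoidsDD :=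
  fun _ _ hz _ h => hf.not_up (t.par_le hz) h.2

/-! ### Avoidance conditions at a node -/

section Node

variable {l m r : NCCode} {b : Bool}

theorem up_node_left {x y : ℕ} (hy : y ≤ l.size) : (node l m r b).Up x y ↔ l.Up x y := by
  refine exists_congr fun i => and_congr_right fun _ => and_congr_right fun h => ?_
  rw [jump_node_left (by omega)]

theorem up_node_mid {x y : ℕ} (hx : x ≤ m.size) :
    (node l m r b).Up (l.size + m.size + 1 - x) (l.size + m.size + 1 - y) ↔ m.Up y x := by
  constructor
  · rintro ⟨i, h1, h2, h3⟩
    refine ⟨l.size + m.size - i, by omega, by omega, ?_⟩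
    rw [← h3, ← jump_node_mid (l := l) (r := r) (b := b) (by omega)]
    congr 1
    omega
  · rintro ⟨i, h1, h2, h3⟩
    exact ⟨l.size + m.size - i, by omega, by omega, by rw [jump_node_mid (by omega), h3]⟩

theorem up_node_right {x y : ℕ} :
    (node l m r b).Up (l.size + m.size + 1 + x) (l.size + m.size + 1 + y) ↔ r.Up x y := by
  constructor
  · rintro ⟨i, h1, h2, h3⟩
    refine ⟨i - (l.size + m.size + 1), by omega, by omega, ?_⟩
    rw [← h3, ← jump_node_right (l := l) (m := m) (r := r) (b := b)]
    congr 1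
    omega
  · rintro ⟨i, h1, h2, h3⟩
    exact ⟨l.size + m.size + 1 + i, by omega, by omega, by rw [jump_node_right, h3]⟩

theorem up_node_last : (node l m r b).Up 0 (l.size + m.size + 1) ↔
    ¬ (l.Flat ∧ m.Flat ∧ b = false) := by
  constructor
  · rintro ⟨i, -, h2, h3⟩ ⟨hl, hm, rfl⟩
    rcases node_gap_cases (l := l) (m := m) (r := r) (b := false) (i := i)
      (by rw [size_node]; omega) with
      h | rfl | ⟨j, h, rfl⟩ | ⟨j, h, rfl⟩
    · rw [jump_node_left h, hl i h] at h3; cases h3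
    · rw [jump_node_gap] at h3; cases h3
    · rw [jump_node_mid h, hm j h] at h3; cases h3
    · omega
  · intro hn
    by_contra hu
    have key : ∀ i, i < l.size + m.size + 1 → (node l m r b).jump i = false := fun i hi => by
      rw [← Bool.not_eq_true]
      exact fun hj => hu ⟨i, Nat.zero_le i, hi, hj⟩
    refine hn ⟨fun i hi => ?_, fun i hi => ?_, ?_⟩
    · rw [← key i (by omega), jump_node_left hi]
    · rw [← key (l.size + m.size - i) (by omega), jump_node_mid hi]
    · rw [← key l.size (by omega), jump_node_gap]

/-- Labels increase weakly, so if any edge at the root ascends, the one to the largest child does.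
-/
theorem startsUp_node : (node l m r b).StartsUp ↔ ¬ (l.Flat ∧ m.Flat ∧ b = false) := by
  rw [← up_node_last (r := r)]
  constructor
  · rintro ⟨y, h0, h1, h2, i, h3, h4, h5⟩
    refine ⟨i, h3, ?_, h5⟩
    rcases node_point_cases h1 with h | ⟨x, x0, h, rfl⟩ | rfl | ⟨x, x0, h, rfl⟩
    · omega
    · omega
    · exact h4
    · rw [par_node_right x0] at h2; omega
  · exact fun h => ⟨_, by omega, by rw [size_node]; omega, par_node_last, h⟩

theorem Up.lt {t : NCCode} {x y : ℕ} (h : t.Up x y) : x < y := by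
  obtain ⟨i, h1, h2, -⟩ := h
  omega

/-- Conditions on consecutive edges in a tree, in terms of the parts of its code. -/
theorem forall_par_node {C C' : NCCode → ℕ → ℕ → Prop}
    (hl : ∀ x y, x ≤ l.size → y ≤ l.size → (C (node l m r b) x y ↔ C l x y))
    (hm : ∀ x y, x ≤ m.size → y ≤ m.size →
      (C (node l m r b) (l.size + m.size + 1 - x) (l.size + m.size + 1 - y) ↔ C' m x y))
    (hr : ∀ x y, x ≤ r.size → y ≤ r.size →
      (C (node l m r b) (l.size + m.size + 1 + x) (l.size + m.size + 1 + y) ↔ C r x y)) :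
    (∀ z, 0 < z → z ≤ (node l m r b).size → 0 < (node l m r b).par z →
      ¬ (C (node l m r b) ((node l m r b).par ((node l m r b).par z)) ((node l m r b).par z) ∧
        C (node l m r b) ((node l m r b).par z) z)) ↔
    (∀ z, 0 < z → z ≤ l.size → 0 < l.par z → ¬ (C l (l.par (l.par z)) (l.par z) ∧ C l (l.par z) z)) ∧
    (∀ z, 0 < z → z ≤ m.size → 0 < m.par z →
      ¬ (C' m (m.par (m.par z)) (m.par z) ∧ C' m (m.par z) z)) ∧
    (∀ z, 0 < z → z ≤ r.size → 0 < r.par z →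
      ¬ (C r (r.par (r.par z)) (r.par z) ∧ C r (r.par z) z)) ∧
    (C (node l m r b) 0 (l.size + m.size + 1) →
      (∀ z, 0 < z → z ≤ m.size → m.par z = 0 → ¬ C' m 0 z) ∧
      (∀ z, 0 < z → z ≤ r.size → r.par z = 0 → ¬ C r 0 z)) := by
  constructor
  · intro H
    refine ⟨fun z z0 hz hp => ?_, fun z z0 hz hp => ?_, fun z z0 hz hp => ?_, fun hc =>
      ⟨fun z z0 hz hp => ?_, fun z z0 hz hp => ?_⟩⟩
    · have h1 := l.par_le hz
      have h2 := l.par_le h1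
      have := H z z0 (by rw [size_node]; omega)
      rw [par_node_left hz, par_node_left h1, hl _ _ h2 h1, hl _ _ h1 hz] at this
      exact this hp
    · have h1 := m.par_le hz
      have h2 := m.par_le h1
      have := H (l.size + m.size + 1 - z) (by omega) (by rw [size_node]; omega)
      rw [par_node_mid z0 hz, par_node_mid hp h1, hm _ _ h2 h1, hm _ _ h1 hz] at this
      exact this (by omega)
    · have h1 := r.par_le hz
      have h2 := r.par_le h1
      have := H (l.size + m.size + 1 + z) (by omega) (by rw [size_node]; omega)
      rw [par_node_right z0, par_node_right hp, hr _ _ h2 h1, hr _ _ h1 hz] at this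
      exact this (by omega)
    · have := H (l.size + m.size + 1 - z) (by omega) (by rw [size_node]; omega)
      rw [par_node_mid z0 hz, hp, hm _ _ (Nat.zero_le _) hz, Nat.sub_zero, par_node_last] at this
      exact fun h => this (by omega) ⟨hc, h⟩
    · have := H (l.size + m.size + 1 + z) (by omega) (by rw [size_node]; omega)
      rw [par_node_right z0, hp, hr _ _ (Nat.zero_le _) hz, Nat.add_zero, par_node_last] at this
      exact fun h => this (by omega) ⟨hc, h⟩
  · rintro ⟨Hl, Hm, Hr, Hc⟩ z z0 hz hp
    rcases node_point_cases hz with h | ⟨x, x0, h, rfl⟩ | rfl | ⟨x, x0, h, rfl⟩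
    · have h1 := l.par_le h
      have h2 := l.par_le h1
      rw [par_node_left h] at hp
      rw [par_node_left h, par_node_left h1, hl _ _ h2 h1, hl _ _ h1 h]
      exact Hl z z0 h hp
    · have h1 := m.par_le h
      have h2 := m.par_le h1
      rw [par_node_mid x0 h]
      -- If `x` is a child of the root of `m`, its parent in the whole tree is the largest child and
      -- its grandparent is `0`: this pair of edges straddles the pieces.
      rcases (m.par x).eq_zero_or_pos with hq | hq
      · rw [hq, hm _ _ (Nat.zero_le _) h, Nat.sub_zero, par_node_last]
        exact fun hh => (Hc hh.1).1 x x0 h hq hh.2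
      · rw [par_node_mid hq h1, hm _ _ h2 h1, hm _ _ h1 h]
        exact Hm x x0 h hq
    · rw [par_node_last] at hp
      omega
    · have h1 := r.par_le h
      have h2 := r.par_le h1
      rw [par_node_right x0]
      rcases (r.par x).eq_zero_or_pos with hq | hq
      · rw [hq, hr _ _ (Nat.zero_le _) h, Nat.add_zero, par_node_last]
        exact fun hh => (Hc hh.1).2 x x0 h hq hh.2
      · rw [par_node_right hq, hr _ _ h2 h1, hr _ _ h1 h]
        exact Hr x x0 h hq

/-- After an ascent from `0` to the largest child, a second ascent can only enter the right part,
since the middle part lies at smaller points. -/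
theorem avoidsUU_node : (node l m r b).AvoidsUU ↔
    l.AvoidsUU ∧ m.AvoidsDD ∧ r.AvoidsUU ∧ ((l.Flat ∧ m.Flat ∧ b = false) ∨ ¬ r.StartsUp) := by
  refine (forall_par_node (C := fun t x y => t.Up x y) (C' := fun t x y => t.Up y x)
    (fun x y _ hy => up_node_left hy) (fun x y hx _ => up_node_mid hx)
    (fun x y _ _ => up_node_right)).trans ?_
  refine and_congr_right fun _ => and_congr_right fun _ => and_congr_right fun _ => ?_
  rw [up_node_last, or_iff_not_imp_left]
  refine imp_congr_right fun _ => ?_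
  constructor
  · rintro ⟨-, h⟩ ⟨y, h0, h1, h2, h3⟩
    exact h y h0 h1 h2 h3
  · exact fun h => ⟨fun z z0 _ _ hz => absurd hz.lt (by omega),
      fun z z0 hz hp hu => h ⟨z, z0, hz, hp, hu⟩⟩

theorem avoidsDD_node : (node l m r b).AvoidsDD ↔
    l.AvoidsDD ∧ m.AvoidsUU ∧ r.AvoidsDD := by
  refine (forall_par_node (C := fun t x y => t.Up y x) (C' := fun t x y => t.Up x y)
    (fun x y hx _ => up_node_left hx) (fun x y _ hy => up_node_mid hy)
    (fun x y _ _ => up_node_right)).trans ?_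
  refine and_congr_right fun _ => and_congr_right fun _ => and_iff_left ?_
  exact fun h => absurd h.lt (by omega)

end Node

/-! ### Generating functions of codes -/

theorem finite_size_eq (n : ℕ) : {t : NCCode | t.size = n}.Finite :=
  Set.finite_coe_iff.1 (Finite.of_injective
    (fun t : {t : NCCode | t.size = n} => t.1.toGNC n t.2)
    fun _ _ e => Subtype.ext (toGNC_injective e))

/-- The codes with `n` edges. -/
noncomputable def codes (n : ℕ) : Finset NCCode := (finite_size_eq n).toFinset

theorem mem_codes {n : ℕ} {t : NCCode} : t ∈ codes n ↔ t.size = n := by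
  rw [codes, Set.Finite.mem_toFinset]
  exact Iff.rfl

theorem codes_zero : codes 0 = {leaf} := by
  ext t
  rw [mem_codes, Finset.mem_singleton]
  cases t <;> simp [size]

theorem sum_gncTree {M : Type*} [AddCommMonoid M] {n : ℕ} {g : GNCTree n → M} {f : NCCode → M}
    (hfg : ∀ t h, g (t.toGNC n h) = f t) : ∑ T, g T = ∑ t ∈ codes n, f t := by
  symm
  refine Finset.sum_bij (fun t ht => t.toGNC n (mem_codes.1 ht)) (fun _ _ => Finset.mem_univ _)
    (fun _ _ _ _ e => toGNC_injective e) (fun T _ => ?_) (fun t ht => (hfg t _).symm)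
  obtain ⟨t, h, e⟩ := T.exists_toGNC_eq
  exact ⟨t, mem_codes.2 h, e⟩

/-- The nested antidiagonals, splitting `r` off first and then `l` from `m`, match the coefficients
of a triple product in `coeff_gf_mul`. -/
theorem sum_codes_succ {M : Type*} [AddCommMonoid M] (n : ℕ) (f : NCCode → M) :
    ∑ t ∈ codes (n + 1), f t =
      ∑ a ∈ Finset.HasAntidiagonal.antidiagonal n, ∑ c ∈ Finset.HasAntidiagonal.antidiagonal a.1,
        ∑ x ∈ codes c.1 ×ˢ codes c.2 ×ˢ codes a.2 ×ˢ (Finset.univ : Finset Bool),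
          f (node x.1 x.2.1 x.2.2.1 x.2.2.2) := by
  simp only [Finset.sum_sigma']
  symm
  refine Finset.sum_bij (fun x _ => node x.2.2.1 x.2.2.2.1 x.2.2.2.2.1 x.2.2.2.2.2)
    ?_ ?_ ?_ (fun _ _ => rfl)
  · rintro ⟨⟨i, j⟩, ⟨k, l⟩, x⟩ h
    simp only [Finset.mem_sigma, Finset.HasAntidiagonal.mem_antidiagonal, Finset.mem_product, mem_codes,
      Finset.mem_univ, and_true] at h
    rw [mem_codes, size_node]
    dsimp only
    omega
  · rintro ⟨⟨i, j⟩, ⟨k, l⟩, x1, x2, x3, x4⟩ h ⟨⟨i', j'⟩, ⟨k', l'⟩, y1, y2, y3, y4⟩ h' e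
    simp only [Finset.mem_sigma, Finset.HasAntidiagonal.mem_antidiagonal, Finset.mem_product, mem_codes,
      Finset.mem_univ, and_true] at h h'
    simp only [node.injEq] at e
    obtain ⟨rfl, rfl, rfl, rfl⟩ := e
    obtain ⟨h1, h2, rfl, rfl, rfl⟩ := h
    obtain ⟨h1', h2', rfl, rfl, rfl⟩ := h'
    obtain rfl := h2
    obtain rfl := h2'
    rfl
  · intro t ht
    rw [mem_codes] at ht
    cases t with
    | leaf => simp [size] at ht
    | node l m r b =>
      rw [size_node] at ht
      refine ⟨⟨(l.size + m.size, r.size), (l.size, m.size), l, m, r, b⟩, ?_, rfl⟩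
      simp only [Finset.mem_sigma, Finset.HasAntidiagonal.mem_antidiagonal, Finset.mem_product, mem_codes,
        Finset.mem_univ, and_true]
      omega

variable {R : Type*} [CommRing R]

/-- The generating function of the codes with weights `f`. -/
noncomputable def gf (f : NCCode → R) : R⟦X⟧ := PowerSeries.mk fun n => ∑ t ∈ codes n, f t

theorem coeff_gf_mul (α β γ : NCCode → R) (δ : Bool → R) (n : ℕ) :
    PowerSeries.coeff n (gf α * gf β * gf γ * PowerSeries.C (δ true + δ false)) =
      ∑ a ∈ Finset.HasAntidiagonal.antidiagonal n, ∑ c ∈ Finset.HasAntidiagonal.antidiagonal a.1,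
        ∑ x ∈ codes c.1 ×ˢ codes c.2 ×ˢ codes a.2 ×ˢ (Finset.univ : Finset Bool),
          α x.1 * β x.2.1 * γ x.2.2.1 * δ x.2.2.2 := by
  rw [PowerSeries.coeff_mul_C, PowerSeries.coeff_mul, Finset.sum_mul]
  refine Finset.sum_congr rfl fun a _ => ?_
  rw [PowerSeries.coeff_mul, Finset.sum_mul, Finset.sum_mul]
  refine Finset.sum_congr rfl fun c _ => ?_
  simp only [gf, PowerSeries.coeff_mk, Finset.sum_product, Fintype.sum_bool,
    ← Finset.sum_mul, ← Finset.mul_sum]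

/-- The generating function of a weight that is multiplicative on nodes, up to a sum of two such
products. -/
theorem gf_eq {f α β γ α' β' γ' : NCCode → R} {δ δ' : Bool → R} (h0 : f leaf = 1)
    (h : ∀ l m r b, f (node l m r b) = α l * β m * γ r * δ b + α' l * β' m * γ' r * δ' b) :
    gf f = 1 + PowerSeries.X * (gf α * gf β * gf γ * PowerSeries.C (δ true + δ false) +
      gf α' * gf β' * gf γ' * PowerSeries.C (δ' true + δ' false)) := by
  ext n
  cases n with
  | zero => simp [gf, codes_zero, h0]
  | succ n =>
    rw [map_add, PowerSeries.coeff_succ_X_mul, map_add, coeff_gf_mul, coeff_gf_mul,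
      PowerSeries.coeff_one, if_neg (Nat.succ_ne_zero n), zero_add, gf, PowerSeries.coeff_mk,
      sum_codes_succ]
    simp only [← Finset.sum_add_distrib, h]

theorem gf_sub (f g : NCCode → R) : gf (fun t => f t - g t) = gf f - gf g := by
  ext n
  simp [gf]

end NCCode

/-! ### The system of equations and its unique solution -/

section

open NCCode Classical

variable {R : Type*} [CommRing R]

/-- As `0 ^ 0 = 1`, the weight is the indicator of having neither ascents nor descents. -/
theorem GNCTree.genFun_zero_one_zero :
    GNCTree.genFun (0 : R) 1 0 = gf fun t => if t.Flat then 1 else 0 := by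
  ext n
  rw [GNCTree.genFun, gf, PowerSeries.coeff_mk, PowerSeries.coeff_mk]
  refine sum_gncTree fun t h => ?_
  rw [GNCTree.weight, one_pow, mul_one, zero_pow_eq, zero_pow_eq, ← toGNC_edgeCount_eq_zero (h := h)]
  split_ifs <;> simp_all

theorem GNCTree.avoidGenFun_one {σ : List GNCStep} {P : NCCode → Prop}
    (hP : ∀ n t h, (t.toGNC n h).Avoids σ ↔ P t) :
    GNCTree.avoidGenFun σ (1 : R) 1 1 = gf fun t => if P t then 1 else 0 := by
  ext n
  rw [GNCTree.avoidGenFun, gf, PowerSeries.coeff_mk, PowerSeries.coeff_mk, Finset.sum_filter]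
  refine sum_gncTree fun t h => ?_
  simp only [hP, GNCTree.weight, one_pow, mul_one]

/-- The system of equations of the generating functions. -/
theorem NCCode.gf_system {A U D : R⟦X⟧} (hA : A = gf fun t => if t.Flat then 1 else 0)
    (hU : U = gf fun t => if t.AvoidsUU then 1 else 0)
    (hD : D = gf fun t => if t.AvoidsDD then 1 else 0) :
    U = (1 - PowerSeries.X * A ^ 2 + 2 * PowerSeries.X * U * D) *
        (1 + PowerSeries.X * A ^ 2 * U) ∧
      D = 1 + 2 * PowerSeries.X * D ^ 2 * U := by
  have flat_leaf : leaf.Flat := fun i hi => by simp [size] at hi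
  have not_startsUp_leaf : ¬ leaf.StartsUp := by
    rintro ⟨y, h0, h1, -⟩
    simp only [size] at h1
    omega
  -- The series `S`; a single product suffices, so the second one is zero.
  have hS := gf_eq (R := R) (f := fun t => if t.AvoidsUU ∧ ¬ t.StartsUp then 1 else 0)
    (α := fun t => if t.Flat then 1 else 0) (β := fun t => if t.Flat then 1 else 0)
    (γ := fun t => if t.AvoidsUU then 1 else 0) (δ := fun b => if b = false then 1 else 0)
    (α' := fun _ => 0) (β' := fun _ => 0) (γ' := fun _ => 0) (δ' := fun _ => 0)
    (if_pos ⟨flat_leaf.avoidsUU, not_startsUp_leaf⟩) (fun l m r b => by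
      have h1 := Flat.avoidsUU (t := l)
      have h2 := Flat.avoidsDD (t := m)
      simp only [avoidsUU_node, startsUp_node, not_not, mul_zero, add_zero, mul_ite, mul_one]
      split_ifs <;> simp_all)
  -- The second product takes all `l`, `m`, `b` with `r` counted by `S`; the first adds, when the
  -- edge to the largest child is level, the remaining `r`, counted by `U - S`.
  have hU' := gf_eq (R := R) (f := fun t => if t.AvoidsUU then 1 else 0)
    (α := fun t => if t.Flat then 1 else 0) (β := fun t => if t.Flat then 1 else 0)
    (γ := fun t => (if t.AvoidsUU then 1 else 0) - if t.AvoidsUU ∧ ¬ t.StartsUp then 1 else 0)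
    (δ := fun b => if b = false then 1 else 0)
    (α' := fun t => if t.AvoidsUU then 1 else 0) (β' := fun t => if t.AvoidsDD then 1 else 0)
    (γ' := fun t => if t.AvoidsUU ∧ ¬ t.StartsUp then 1 else 0) (δ' := fun _ => 1)
    (if_pos flat_leaf.avoidsUU) (fun l m r b => by
      have h1 := Flat.avoidsUU (t := l)
      have h2 := Flat.avoidsDD (t := m)
      simp only [avoidsUU_node]
      by_cases hf : l.Flat ∧ m.Flat ∧ b = false
      · simp [hf, h1 hf.1, h2 hf.2.1]
      · by_cases a1 : l.Flat <;> by_cases a2 : m.Flat <;> by_cases a3 : b = false <;>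
          by_cases a4 : l.AvoidsUU <;> by_cases a5 : m.AvoidsDD <;> by_cases a6 : r.AvoidsUU <;>
          by_cases a7 : r.StartsUp <;> simp_all)
  have hD' := gf_eq (R := R) (f := fun t => if t.AvoidsDD then 1 else 0)
    (α := fun t => if t.AvoidsDD then 1 else 0) (β := fun t => if t.AvoidsUU then 1 else 0)
    (γ := fun t => if t.AvoidsDD then 1 else 0) (δ := fun _ => 1)
    (α' := fun _ => 0) (β' := fun _ => 0) (γ' := fun _ => 0) (δ' := fun _ => 0)
    (if_pos flat_leaf.avoidsDD) (fun l m r b => by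
      simp only [avoidsDD_node]
      by_cases a1 : l.AvoidsDD <;> by_cases a2 : m.AvoidsUU <;> by_cases a3 : r.AvoidsDD <;>
        simp [a1, a2, a3])
  rw [gf_sub] at hU'
  rw [← hA, ← hU] at hS
  rw [← hA, ← hU, ← hD] at hU'
  rw [← hD, ← hU] at hD'
  simp only [Bool.true_eq_false, if_true, if_false, zero_add, add_zero, map_zero, map_one,
    mul_zero, mul_one, one_add_one_eq_two, map_ofNat] at hS hU' hD'
  constructor
  · rw [show 1 + PowerSeries.X * A ^ 2 * U = 1 + PowerSeries.X * (A * A * U) by ring, ← hS]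
    -- With `1 + X·A²·U` replaced by `S`, the claim reads `U = (1 - X·A² + 2X·U·D)·S`.
    linear_combination hU' - hS
  · linear_combination hD'

/-- The system of equations has at most one solution. -/
theorem PowerSeries.system_unique {B U D U' D' : R⟦X⟧}
    (hU : U = (1 - PowerSeries.X * B + 2 * PowerSeries.X * U * D) * (1 + PowerSeries.X * B * U))
    (hD : D = 1 + 2 * PowerSeries.X * D ^ 2 * U)
    (hU' : U' = (1 - PowerSeries.X * B + 2 * PowerSeries.X * U' * D') *
      (1 + PowerSeries.X * B * U'))
    (hD' : D' = 1 + 2 * PowerSeries.X * D' ^ 2 * U') : U = U' ∧ D = D' := by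
  have key : ∀ n : ℕ, (PowerSeries.X : R⟦X⟧) ^ n ∣ U - U' ∧ (PowerSeries.X : R⟦X⟧) ^ n ∣ D - D' := by
    intro n
    induction n with
    | zero => simp
    | succ n ih =>
      obtain ⟨⟨a, ha⟩, ⟨b, hb⟩⟩ := ih
      have ea : U = U' + PowerSeries.X ^ n * a := by linear_combination ha
      have eb : D = D' + PowerSeries.X ^ n * b := by linear_combination hb
      constructor
      -- The witness telescopes `P·Q - P'·Q' = P·(Q - Q') + (P - P')·Q'` for the two factors, with
      -- `U·D - U'·D' = (U - U')·D + U'·(D - D')`; each difference supplies the extra `X`.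
      · refine ⟨(1 - PowerSeries.X * B + 2 * PowerSeries.X * U * D) * B * a +
          2 * (a * D + U' * b) * (1 + PowerSeries.X * B * U'), ?_⟩
        linear_combination hU - hU' +
          ((1 - PowerSeries.X * B + 2 * PowerSeries.X * U * D) * PowerSeries.X * B +
            2 * PowerSeries.X * D * (1 + PowerSeries.X * B * U')) * ha +
          2 * PowerSeries.X * U' * (1 + PowerSeries.X * B * U') * hb
      · refine ⟨2 * (D ^ 2 * a + (D + D') * b * U'), ?_⟩
        linear_combination hD - hD' + 2 * PowerSeries.X * D ^ 2 * ha +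
          2 * PowerSeries.X * (D + D') * U' * hb
  have zero : ∀ f : R⟦X⟧, (∀ n : ℕ, (PowerSeries.X : R⟦X⟧) ^ n ∣ f) → f = 0 := fun f hf => by
    ext n
    exact PowerSeries.X_pow_dvd_iff.1 (hf (n + 1)) n (Nat.lt_succ_self n)
  exact ⟨sub_eq_zero.1 (zero _ fun n => (key n).1), sub_eq_zero.1 (zero _ fun n => (key n).2)⟩

end

theorem mainTheorem10 (R : Type*) [CommRing R] (A U D : R⟦X⟧)
    (hA : A = GNCTree.genFun (0 : R) 1 0) :
    (U = GNCTree.avoidGenFun [GNCStep.u, GNCStep.u] (1 : R) 1 1 ∧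
      D = GNCTree.avoidGenFun [GNCStep.d, GNCStep.d] (1 : R) 1 1) ↔
    (U = (1 - PowerSeries.X * A ^ 2 + 2 * PowerSeries.X * U * D) *
        (1 + PowerSeries.X * A ^ 2 * U) ∧
      D = 1 + 2 * PowerSeries.X * D ^ 2 * U) := by
  classical
  rw [GNCTree.genFun_zero_one_zero] at hA
  rw [GNCTree.avoidGenFun_one fun n t h => NCCode.toGNC_avoids_uu,
    GNCTree.avoidGenFun_one fun n t h => NCCode.toGNC_avoids_dd]
  constructor
  · rintro ⟨hU, hD⟩
    exact NCCode.gf_system hA hU hD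
  · rintro ⟨hU, hD⟩
    obtain ⟨hU', hD'⟩ := NCCode.gf_system hA rfl rfl
    exact PowerSeries.system_unique hU hD hU' hD'
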